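/- Notation. For real $a$ and an integer $k\ge 0$ let $(a)_k=a(a+1)\cdots(a+k-1)$, $(a)_0=1$; empty products are $1$. Let $\hat p_s$ be the Legendre polynomial of degree $s$ with positive leading coefficient, normalized by $\int_{-1}^1\hat p_s(t)^2\,dt=1$. For $n\ge 0$, $0\le k\le n$, and $0\le i\le n$ with $i=0$ or $i$ odd, put $$d^i_{n,k}=(-1)^n\frac{\sqrt{2n-2i+1}}{(-n)_i}\,\frac{(-n)_k(n-i+1)_k}{(1)_k(1)_k}\prod_{m=0}^{(i-1)/2}(n+k+1-2m)\prod_{m=0}^{(i-3)/2}(n-k-1-2m),$$ where both products are empty for $i=0$. For $0\le i\le n$ let $h^n_{n-i}$ be the function given for $0\le t<1$ by $$h^n_{n-i}(t)=\sum_{k=0}^n d^i_{n,k}t^k\ \text{ if } i=0 \text{ or } i \text{ is odd},\qquad h^n_{n-i}(t)=\sum_{k=0}^{n-1}d^{i-1}_{n-1,k}t^k\ \text{ if } i>0 \text{ is even},$$ extended to $[-1,0)$ by $h^n_r(-t)=(-1)^{r+1}h^n_r(t)$. Let $\psi^n_r(t)=h^n_r(2t-1)$ for $t\in[0,1)$ and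 $\psi^n_r(t)=0$ otherwise. Let $D^n_1$ be the $(n+1)\times(n+1)$ matrix with entries $$(D^n_1)_{r,s}=2\int_0^1\psi^n_r\!\left(\tfrac{t+1}{2}\right)\hat p_s(2t-1)\,dt=2\int_0^1h^n_r(t)\,\hat p_s(2t-1)\,dt,\qquad 0\le r,s\le n.$$ Theorem. Let $n,i,j$ be integers with $i$ odd and $0\le j<i<n$. Then $$(D^{n+1}_1)_{n-i+1,\,n-j+1}+k^1_{n,i,j}\,(D^n_1)_{n-i,\,n-j}+k^2_{n,i,j}\,(D^{n-1}_1)_{n-i-1,\,n-j-1}=0,$$ where $$k^1_{n,i,j}=h\left(\left(cd(a-b)-\frac{b(e-a)(f-a)(g-a)}{a-b-1}\right)\frac{1+a-b}{a(e-b)(f-b)(g-b)}-1\right),$$ $$k^2_{n,i,j}=l\,\frac{b(e-a)(f-a)(g-a)(1+a-b)}{(a-b-1)\,a(e-b)(f-b)(g-b)},$$ with $$a=n+\frac{3-j}{2},\quad b=-n+\frac{i+j}{2},\quad c=-\frac j2,\quad d=\frac{j-i+1}{2},\quad e=1,\quad f=\frac12,\quad g=\frac32,$$ $$h=\frac{\sqrt{2(n-i)+3}\,\sqrt{2(n-j)+3}\,(2n-i-j+1)}{\sqrt{2(n-i)+1}\,\sqrt{2(n-j)+1}\,(2n-j+2)},$$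 $$l=\frac{\sqrt{2(n-i)+3}\,\sqrt{2(n-j)+3}\,(2n-i-j-1)(2n-i-j+1)}{\sqrt{2(n-i)-1}\,\sqrt{2(n-j)-1}\,(2n-j)(2n-j+2)}.$$ -/

import Mathlib

noncomputable section

namespace AlpertWavelet

/-- The rising factorial `(a)_k = a (a + 1) ⋯ (a + k - 1)`, with `(a)_0 = 1`. -/
def poch (a : ℝ) (k : ℕ) : ℝ := (ascPochhammer ℝ k).eval a

/-- The Legendre polynomial of degree `j`, orthonormal on `[-1, 1]`, with positive leading
coefficient. Mathlib's `Polynomial.shiftedLegendre j` is `x ↦ P_j (1 - 2 x)`, where `P_j` is the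
classical Legendre polynomial, so that its value at `(1 - t) / 2` is `P_j t`. -/
def legendreHat (j : ℕ) (t : ℝ) : ℝ :=
  √(2 * (j : ℝ) + 1) / √2 * Polynomial.aeval ((1 - t) / 2) (Polynomial.shiftedLegendre j)

/-- The coefficients `d^i_{n,k}`, used for `i = 0` and for `i` odd. The first product runs over
`0 ≤ m ≤ (i - 1) / 2` and the second over `0 ≤ m ≤ (i - 3) / 2`; both are empty for `i = 0`, and
the second one is empty for `i = 1`. -/
def waveCoeff (n i k : ℕ) : ℝ :=
  (-1) ^ n * (√(2 * (n : ℝ) - 2 * (i : ℝ) + 1) / poch (-(n : ℝ)) i)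
    * (poch (-(n : ℝ)) k * poch ((n : ℝ) - (i : ℝ) + 1) k / (poch 1 k * poch 1 k))
    * (∏ m ∈ Finset.range ((i + 1) / 2), ((n : ℝ) + (k : ℝ) + 1 - 2 * (m : ℝ)))
    * ∏ m ∈ Finset.range ((i - 1) / 2), ((n : ℝ) - (k : ℝ) - 1 - 2 * (m : ℝ))

/-- The polynomial that gives `h^n_{n-i}` on `[0, 1)`. -/
def wavePoly (n i : ℕ) (t : ℝ) : ℝ :=
  if i = 0 ∨ Odd i then ∑ k ∈ Finset.range (n + 1), waveCoeff n i k * t ^ k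
  else ∑ k ∈ Finset.range n, waveCoeff (n - 1) (i - 1) k * t ^ k

/-- The function `h^n_r`, `0 ≤ r ≤ n`: a polynomial on `[0, 1)`, extended to `[-1, 0)` by
`h^n_r (-t) = (-1)^(r+1) h^n_r t`, and zero outside `[-1, 1)`. -/
def waveFun (n r : ℕ) (t : ℝ) : ℝ :=
  if 0 ≤ t ∧ t < 1 then wavePoly n (n - r) t
  else if -1 ≤ t ∧ t < 0 then (-1) ^ (r + 1) * wavePoly n (n - r) (-t)
  else 0

/-- The wavelet `ψ^n_r (t) = h^n_r (2 t - 1)` on `[0, 1)`, zero elsewhere. -/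
def wavelet (n r : ℕ) : ℝ → ℝ :=
  Set.indicator (Set.Ico 0 1) fun t => waveFun n r (2 * t - 1)

/-- The `(n + 1) × (n + 1)` matrix `D^n_1`, rows and columns numbered from `0` to `n`:
`(D^n_1)_{r,s} = 2 ∫_0^1 ψ^n_r ((t + 1) / 2) p̂_s (2 t - 1) dt`. -/
def matD (n : ℕ) : Matrix (Fin (n + 1)) (Fin (n + 1)) ℝ :=
  Matrix.of fun r s =>
    2 * ∫ t in (0 : ℝ)..1, wavelet n (r : ℕ) ((t + 1) / 2) * legendreHat (s : ℕ) (2 * t - 1)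

end AlpertWavelet

end

namespace AlpertWavelet

/-! The proof reduces each entry to a terminating hypergeometric sum and applies creative
telescoping. By Rodrigues' formula the moment of `t ^ k` against the Legendre polynomial of degree
`n - j` vanishes for `k < n - j`, so only `k = n - p` with `p ≤ j < i` matters. For odd `p` the
second product in `waveCoeff` has a zero factor; for `p = 2 q` the term splits as `topFactor i j (n
- q) * lowFactor i j q` (`waveCoeff_mul_moment`, `matD_eq_entrySum`).

Changing `n` affects only `topFactor`, whose successive ratio is rational. The certificate `cert`
makes the combination of the three summands a difference in `q` (`cert_identity`, `partial_sum_eq`);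
both boundary terms vanish, giving `entrySum_recurrence`. Finally the stated coefficients are, up to
the square-root normalizations, the quotients of `recMid` and `recLast` by `recDen`. -/

/-! ### Legendre moments and entries as finite sums -/

theorem intervalIntegrable_eval (p : Polynomial ℝ) (x y : ℝ) :
    IntervalIntegrable (fun t => p.eval t) MeasureTheory.volume x y :=
  p.continuous.intervalIntegrable x y

theorem integral_eval_mul_derivative (g f : Polynomial ℝ) :
    ∫ t in (0 : ℝ)..1, g.eval t * f.derivative.eval t =
      g.eval 1 * f.eval 1 - g.eval 0 * f.eval 0
        - ∫ t in (0 : ℝ)..1, g.derivative.eval t * f.eval t :=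
  intervalIntegral.integral_mul_deriv_eq_deriv_mul (fun t _ => g.hasDerivAt t)
    (fun t _ => f.hasDerivAt t) (intervalIntegrable_eval _ _ _) (intervalIntegrable_eval _ _ _)

/-- Repeated integration by parts against a polynomial vanishing to order `s` at both ends. -/
theorem integral_eval_mul_iterate_derivative (f : Polynomial ℝ) (s : ℕ)
    (h₀ : ∀ m < s, (Polynomial.derivative^[m] f).eval 0 = 0)
    (h₁ : ∀ m < s, (Polynomial.derivative^[m] f).eval 1 = 0) (g : Polynomial ℝ) :
    ∫ t in (0 : ℝ)..1, g.eval t * (Polynomial.derivative^[s] f).eval t =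
      (-1) ^ s * ∫ t in (0 : ℝ)..1, (Polynomial.derivative^[s] g).eval t * f.eval t := by
  induction s generalizing g with
  | zero => simp
  | succ s ih =>
    rw [Function.iterate_succ_apply', integral_eval_mul_derivative, h₀ s (by omega),
      h₁ s (by omega), ih (fun m hm => h₀ m (by omega)) (fun m hm => h₁ m (by omega)),
      ← Function.iterate_succ_apply]
    ring

theorem integral_pow_mul_one_sub_pow (p s : ℕ) :
    ∫ t in (0 : ℝ)..1, t ^ p * (1 - t) ^ s =
      (p.factorial * s.factorial : ℝ) / (p + s + 1).factorial := by
  induction s generalizing p with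
  | zero =>
    simp only [pow_zero, mul_one, integral_pow, add_zero, Nat.factorial_succ]
    have := Nat.factorial_ne_zero p
    push_cast
    field_simp
    simp
  | succ s ih =>
    have key := integral_eval_mul_derivative ((1 - Polynomial.X) ^ (s + 1))
      (Polynomial.X ^ (p + 1))
    simp only [Polynomial.derivative_pow, Polynomial.derivative_X, Polynomial.derivative_sub,
      Polynomial.derivative_one, Polynomial.eval_mul, Polynomial.eval_pow, Polynomial.eval_sub,
      Polynomial.eval_one, Polynomial.eval_X, Polynomial.eval_C, Polynomial.eval_zero,
      Nat.add_sub_cancel] at key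
    have e₁ : ∫ t in (0 : ℝ)..1, (1 - t) ^ (s + 1) * (((p + 1 : ℕ) : ℝ) * t ^ p * 1) =
        (p + 1 : ℕ) * ∫ t in (0 : ℝ)..1, t ^ p * (1 - t) ^ (s + 1) := by
      rw [← intervalIntegral.integral_const_mul]
      congr 1; ext t; ring
    have e₂ : ∫ t in (0 : ℝ)..1, ((s + 1 : ℕ) : ℝ) * (1 - t) ^ s * (0 - 1) * t ^ (p + 1) =
        -((s + 1 : ℕ) * ∫ t in (0 : ℝ)..1, t ^ (p + 1) * (1 - t) ^ s) := by
      rw [← intervalIntegral.integral_const_mul, ← intervalIntegral.integral_neg]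
      congr 1; ext t; ring
    rw [e₁, e₂, ih] at key
    have hp : ((p + 1 : ℕ) : ℝ) ≠ 0 := by positivity
    apply mul_left_cancel₀ hp
    rw [key, show p + 1 + s + 1 = p + (s + 1) + 1 by ring, Nat.factorial_succ p,
      Nat.factorial_succ s]
    push_cast
    simp
    ring

theorem factorial_mul_aeval_shiftedLegendre (s : ℕ) (t : ℝ) :
    (s.factorial : ℝ) * Polynomial.aeval t (Polynomial.shiftedLegendre s) =
      (Polynomial.derivative^[s]
        (Polynomial.X ^ s * (1 - Polynomial.X) ^ s : Polynomial ℝ)).eval t := by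
  have h := congrArg (Polynomial.aeval t) (Polynomial.factorial_mul_shiftedLegendre_eq s)
  rw [map_mul, map_natCast] at h
  rw [h, ← Polynomial.eval_map_algebraMap, ← Polynomial.iterate_derivative_map]
  simp

/-- The moments of the Legendre polynomial on `[0, 1]`. -/
theorem integral_pow_mul_shiftedLegendre (s k : ℕ) :
    ∫ t in (0 : ℝ)..1, t ^ k * Polynomial.aeval (1 - t) (Polynomial.shiftedLegendre s) =
      if s ≤ k then (k.factorial * k.factorial : ℝ) / ((k - s).factorial * (k + s + 1).factorial)
      else 0 := by
  set f : Polynomial ℝ := Polynomial.X ^ s * (1 - Polynomial.X) ^ s with hf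
  have h₀ : ∀ m < s, (Polynomial.derivative^[m] f).eval 0 = 0 := by
    intro m hm
    have := Polynomial.pow_sub_dvd_iterate_derivative_of_pow_dvd (p := f) (q := Polynomial.X)
      (n := s) m ⟨_, rfl⟩
    exact Polynomial.eval_eq_zero_of_dvd_of_eval_eq_zero this (by simp; omega)
  have h₁ : ∀ m < s, (Polynomial.derivative^[m] f).eval 1 = 0 := by
    intro m hm
    have := Polynomial.pow_sub_dvd_iterate_derivative_of_pow_dvd (p := f) (q := 1 - Polynomial.X)
      (n := s) m ⟨_, mul_comm _ _⟩
    exact Polynomial.eval_eq_zero_of_dvd_of_eval_eq_zero this (by simp; omega)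
  have key := integral_eval_mul_iterate_derivative f s h₀ h₁ (Polynomial.X ^ k)
  have hs : (s.factorial : ℝ) ≠ 0 := by positivity
  have e : ∫ t in (0 : ℝ)..1,
        t ^ k * Polynomial.aeval (1 - t) (Polynomial.shiftedLegendre s) =
      (-1) ^ s * ((s.factorial : ℝ)⁻¹ * ∫ t in (0 : ℝ)..1,
        (Polynomial.X ^ k : Polynomial ℝ).eval t * (Polynomial.derivative^[s] f).eval t) := by
    rw [← intervalIntegral.integral_const_mul, ← intervalIntegral.integral_const_mul]
    congr 1; ext t
    -- Reflection `t ↦ 1 - t` produces a sign `(-1) ^ s`, which later cancels the one from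
    -- integration by parts.
    rw [hf, ← factorial_mul_aeval_shiftedLegendre, Polynomial.shiftedLegendre_eval_symm s (1 - t)]
    simp
    field_simp
  rw [e, key, Polynomial.iterate_derivative_X_pow_eq_natCast_mul]
  split_ifs with h
  · have e' : ∫ t in (0 : ℝ)..1,
        (((k.descFactorial s : ℕ) : Polynomial ℝ) * Polynomial.X ^ (k - s)).eval t * f.eval t =
        k.descFactorial s * ∫ t in (0 : ℝ)..1, t ^ k * (1 - t) ^ s := by
      rw [← intervalIntegral.integral_const_mul]
      congr 1; ext t
      obtain ⟨d, rfl⟩ := Nat.exists_eq_add_of_le h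
      simp [hf, pow_add]
      ring
    have hd : ((k - s).factorial : ℝ) * k.descFactorial s = k.factorial := by
      exact_mod_cast Nat.factorial_mul_descFactorial h
    have hd' : (k.descFactorial s : ℝ) = k.factorial / (k - s).factorial := by
      rw [eq_div_iff (by positivity), mul_comm, hd]
    rw [e', integral_pow_mul_one_sub_pow, hd']
    have h2 : ((-1 : ℝ) ^ s) * (-1) ^ s = 1 := by rw [← mul_pow]; simp
    have : ((k + s + 1).factorial : ℝ) ≠ 0 := by positivity
    have : ((k - s).factorial : ℝ) ≠ 0 := by positivity
    field_simp
    rw [pow_right_comm]; simp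
  · rw [Nat.descFactorial_of_lt (by omega)]
    simp

/-- An entry of `matD` is a finite sum of moments. -/
theorem matD_eq_sum (n i s : ℕ) (hi : Odd i) (hin : i ≤ n) (hs : s < n + 1) :
    matD n ⟨n - i, by omega⟩ ⟨s, hs⟩ =
      2 * (√(2 * (s : ℝ) + 1) / √2) * ∑ k ∈ Finset.range (n + 1), waveCoeff n i k *
        (if s ≤ k then
          (k.factorial * k.factorial : ℝ) / ((k - s).factorial * (k + s + 1).factorial)
        else 0) := by
  simp_rw [← integral_pow_mul_shiftedLegendre, ← intervalIntegral.integral_const_mul]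
  rw [← intervalIntegral.integral_finsetSum, mul_assoc, ← intervalIntegral.integral_const_mul,
    matD, Matrix.of_apply]
  · congr 1
    apply intervalIntegral.integral_congr_ae
    -- The wavelet is cut off to zero at `t = 1`, so it agrees with the polynomial only almost
    -- everywhere.
    have h1 : ∀ᵐ t : ℝ, t ≠ 1 := by
      simp [MeasureTheory.ae_iff]
    filter_upwards [h1] with t ht1 ht
    rw [Set.uIoc_of_le zero_le_one] at ht
    have hlt : t < 1 := lt_of_le_of_ne ht.2 ht1
    have hw : wavelet n (n - i) ((t + 1) / 2) = ∑ k ∈ Finset.range (n + 1),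
        waveCoeff n i k * t ^ k := by
      rw [wavelet, Set.indicator_of_mem (by constructor <;> linarith [ht.1]),
        show 2 * ((t + 1) / 2) - 1 = t by ring, waveFun, if_pos ⟨ht.1.le, hlt⟩,
        Nat.sub_sub_self hin, wavePoly, if_pos (Or.inr hi)]
    rw [hw, legendreHat, show (1 - (2 * t - 1)) / 2 = 1 - t by ring, Finset.sum_mul,
      Finset.mul_sum]
    exact Finset.sum_congr rfl fun k _ => by ring
  · intro k _
    apply Continuous.intervalIntegrable
    have : Continuous fun x : ℝ => Polynomial.aeval x (Polynomial.shiftedLegendre s) :=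
      Polynomial.continuous_aeval _
    fun_prop

/-! ### Creative telescoping -/

/-- Numerator of the rational certificate of the recurrence, as a quadratic in `q`, with
`M = 2 n - j`. -/
def cert (M i j q : ℝ) : ℝ :=
  (33 - 46 * j - 19 * j ^ 2 + 51 * i + 79 * i * j + 24 * i * j ^ 2 - 45 * i ^ 2
      - 38 * i ^ 2 * j - 5 * i ^ 2 * j ^ 2 + 9 * i ^ 3 + 5 * i ^ 3 * j + 56 * M - 153 * M * j
      - 53 * M * j ^ 2 + 140 * M * i + 155 * M * i * j + 27 * M * i * j ^ 2 - 66 * M * i ^ 2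
      - 40 * M * i ^ 2 * j - 2 * M * i ^ 2 * j ^ 2 + 6 * M * i ^ 3 + 2 * M * i ^ 3 * j
      + 27 * M ^ 2 - 149 * M ^ 2 * j - 33 * M ^ 2 * j ^ 2 + 113 * M ^ 2 * i
      + 89 * M ^ 2 * i * j + 7 * M ^ 2 * i * j ^ 2 - 29 * M ^ 2 * i ^ 2
      - 10 * M ^ 2 * i ^ 2 * j + M ^ 2 * i ^ 3 + 4 * M ^ 3 - 58 * M ^ 3 * j
      - 6 * M ^ 3 * j ^ 2 + 36 * M ^ 3 * i + 16 * M ^ 3 * i * j - 4 * M ^ 3 * i ^ 2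
      - 8 * M ^ 4 * j + 4 * M ^ 4 * i)
    + (-28 + 66 * j + 10 * j ^ 2 - 94 * i - 94 * i * j - 12 * i * j ^ 2 + 48 * i ^ 2
      + 30 * i ^ 2 * j + 2 * i ^ 2 * j ^ 2 - 6 * i ^ 3 - 2 * i ^ 3 * j - 2 * M + 188 * M * j
      + 24 * M * j ^ 2 - 162 * M * i - 124 * M * i * j - 8 * M * i * j ^ 2 + 46 * M * i ^ 2
      + 16 * M * i ^ 2 * j - 2 * M * i ^ 3 + 14 * M ^ 2 + 124 * M ^ 2 * j + 8 * M ^ 2 * j ^ 2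
      - 80 * M ^ 2 * i - 36 * M ^ 2 * i * j + 10 * M ^ 2 * i ^ 2 + 4 * M ^ 3 + 24 * M ^ 3 * j
      - 12 * M ^ 3 * i) * q
    + (4 - 20 * j + 40 * i + 24 * i * j - 12 * i ^ 2 - 4 * i ^ 2 * j - 20 * M - 48 * M * j
      + 40 * M * i + 16 * M * i * j - 4 * M * i ^ 2 - 8 * M ^ 2 - 16 * M ^ 2 * j
      + 8 * M ^ 2 * i) * q ^ 2

/-- The common denominator of the coefficients of the recurrence. -/
def recDen (M i : ℝ) : ℝ :=
  (2 * M - i + 1) * (M + 3) * (M + 2) * (M + 2 - i) * (M + 3 - i)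

/-- The middle coefficient of the recurrence, after clearing denominators. -/
def recMid (M i j : ℝ) : ℝ :=
  (-(j * (j - i + 1) * (2 * M + 3 - i) * (2 * M + 1 - i)) - (M - i) * (M + 1) * (M + 2) * M)
      * (2 * M + 5 - i)
    - (M - i + 1) * (2 * M - i + 1) * (M + 3) * (M + 2 - i) * (M + 3 - i)

/-- The last coefficient of the recurrence, after clearing denominators. -/
def recLast (M i : ℝ) : ℝ :=
  (M - i - 1) * (M - i) * (M + 1) * (M + 2) * (2 * M + 5 - i)

/-- The telescoping relation with factorials divided out. With `N = n - 1 - q` one has `v = 2 N - j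
+ 2`; the products on the left are the cleared ratios of `topFactor` at `N + 2`, `N + 1`, `N`, and
the right side is the difference of boundary terms. -/
theorem cert_identity (M i j q v : ℝ) (hv : v = M - 2 * q) :
    recDen M i * ((v + j - i + 1) * (v + j + 3) * ((v + j - i - 1) * (v + j + 1)))
      + recMid M i j * ((v + j - i - 1) * (v + j + 1) * ((v + 3) * (v + 2)))
      + recLast M i * ((v + 3) * (v + 2) * ((v + 1) * v)) =
    (v + 3) * (v + 2) * ((j - 2 * q) * (j - 2 * q - 1)) * cert M i j (q + 1)
      - 2 * q * (2 * q - i) * ((v + j - i - 1) * (v + j + 1)) * cert M i j q := by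
  subst hv
  unfold recDen recMid recLast cert
  ring

/-- The part of the summand of `entrySum` that depends on `N = n - q`. -/
noncomputable def topFactor (i j N : ℕ) : ℝ :=
  ((2 * N - i).factorial : ℝ) * (∏ m ∈ Finset.range ((i + 1) / 2), (2 * (N : ℝ) + 1 - 2 * m))
    / (2 * N + 1 - j).factorial

/-- The part of the summand of `entrySum` that depends on `q` alone. -/
noncomputable def lowFactor (i j q : ℕ) : ℝ :=
  (∏ m ∈ Finset.range ((i - 1) / 2), (2 * (q : ℝ) - 1 - 2 * m))
    / ((2 * q).factorial * (j - 2 * q).factorial)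

/-- The entry `(n - i, n - j)` of `matD n`, up to its normalization. -/
noncomputable def entrySum (n i j : ℕ) : ℝ :=
  ∑ q ∈ Finset.range (j / 2 + 1), topFactor i j (n - q) * lowFactor i j q

/-- Shifting the variable of a product along an arithmetic progression of step `2`. -/
theorem prod_shift (x : ℝ) (m : ℕ) :
    (∏ k ∈ Finset.range m, (x + 2 - 2 * (k : ℝ))) * (x + 2 - 2 * m) =
      (∏ k ∈ Finset.range m, (x - 2 * (k : ℝ))) * (x + 2) := by
  induction m with
  | zero => simp
  | succ m ih =>
    rw [Finset.prod_range_succ, Finset.prod_range_succ, ih]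
    push_cast
    ring

/-- The factor `2 N - i + 2` gained by the factorial cancels against the one lost by the product.
The bounds keep the natural subtractions exact. -/
theorem topFactor_succ (i j N : ℕ) (hi : Odd i) (hiN : i ≤ 2 * N) (hj : j ≤ 2 * N) :
    topFactor i j (N + 1) * ((2 * N - j + 3) * (2 * N - j + 2)) =
      topFactor i j N * ((2 * N - i + 1) * (2 * N + 3)) := by
  obtain ⟨c, rfl⟩ := hi
  obtain ⟨d, hd⟩ := Nat.exists_eq_add_of_le hiN
  obtain ⟨e, he⟩ := Nat.exists_eq_add_of_le hj
  have hs := prod_shift (2 * (N : ℝ) + 1) (c + 1)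
  have hdR : 2 * (N : ℝ) = 2 * c + 1 + d := by exact_mod_cast hd
  have heR : 2 * (N : ℝ) = j + e := by exact_mod_cast he
  unfold topFactor
  rw [show 2 * (N + 1) - (2 * c + 1) = d + 1 + 1 by omega, show 2 * N - (2 * c + 1) = d by omega,
    show 2 * (N + 1) + 1 - j = e + 1 + 1 + 1 by omega, show 2 * N + 1 - j = e + 1 by omega,
    show (2 * c + 1 + 1) / 2 = c + 1 by omega]
  have hp : ∏ m ∈ Finset.range (c + 1), (2 * ((N + 1 : ℕ) : ℝ) + 1 - 2 * m) =
      ∏ m ∈ Finset.range (c + 1), (2 * (N : ℝ) + 1 + 2 - 2 * m) :=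
    Finset.prod_congr rfl fun m _ => by push_cast; ring
  rw [hp]
  set A := ∏ m ∈ Finset.range (c + 1), (2 * (N : ℝ) + 1 + 2 - 2 * m)
  set B := ∏ m ∈ Finset.range (c + 1), (2 * (N : ℝ) + 1 - 2 * m)
  have hA : A * (d + 2) = B * (2 * N + 3) := by
    push_cast at hs
    linear_combination hs - A * hdR
  have := Nat.factorial_ne_zero e
  simp only [Nat.factorial_succ]
  push_cast
  have h₁ : 2 * (N : ℝ) - j + 3 = e + 3 := by linarith
  have h₂ : 2 * (N : ℝ) - j + 2 = e + 2 := by linarith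
  have h₃ : 2 * (N : ℝ) - (2 * c + 1) + 1 = d + 1 := by linarith
  rw [h₁, h₂, h₃]
  field_simp
  linear_combination (e + 2) * (e + 3) * hA

theorem lowFactor_succ (i j q : ℕ) (hi : Odd i) (hq : 2 * q + 2 ≤ j) :
    lowFactor i j (q + 1) * ((2 * q + 2) * (2 * q + 2 - i)) =
      lowFactor i j q * ((j - 2 * q) * (j - 2 * q - 1)) := by
  obtain ⟨c, rfl⟩ := hi
  obtain ⟨d, rfl⟩ := Nat.exists_eq_add_of_le hq
  have hs := prod_shift (2 * (q : ℝ) - 1) c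
  unfold lowFactor
  rw [show 2 * (q + 1) = 2 * q + 1 + 1 by ring, show 2 * q + 2 + d - (2 * q + 1 + 1) = d by omega,
    show 2 * q + 2 + d - 2 * q = d + 1 + 1 by omega, show (2 * c + 1 - 1) / 2 = c by omega]
  have hp : ∏ m ∈ Finset.range c, (2 * ((q + 1 : ℕ) : ℝ) - 1 - 2 * m) =
      ∏ m ∈ Finset.range c, (2 * (q : ℝ) - 1 + 2 - 2 * m) :=
    Finset.prod_congr rfl fun m _ => by push_cast; ring
  rw [hp]
  set A := ∏ m ∈ Finset.range c, (2 * (q : ℝ) - 1 + 2 - 2 * m)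
  set B := ∏ m ∈ Finset.range c, (2 * (q : ℝ) - 1 - 2 * m)
  have := Nat.factorial_ne_zero d
  have := Nat.factorial_ne_zero (2 * q)
  simp only [Nat.factorial_succ]
  push_cast
  have h₁ : 2 * (q : ℝ) + 2 + d - 2 * q = d + 2 := by ring
  have h₂ : (d : ℝ) + 2 - 1 = d + 1 := by ring
  rw [h₁, h₂]
  field_simp
  linear_combination (2 * (q : ℝ) + 2) * (d + 2) * hs

/-- Only the upper boundary term survives. It is written through `lowFactor i j Q` because `j - 2 *
(Q + 1)` may truncate. -/
theorem partial_sum_eq (n i j Q : ℕ) (hi : Odd i) (hji : j < i) (hin : i < n) (hQ : 2 * Q ≤ j) :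
    ∑ q ∈ Finset.range (Q + 1),
      (recDen (2 * n - j) i * topFactor i j (n + 1 - q)
        + recMid (2 * n - j) i j * topFactor i j (n - q)
        + recLast (2 * n - j) i * topFactor i j (n - 1 - q)) * lowFactor i j q =
      topFactor i j (n - 1 - Q) * lowFactor i j Q * ((j - 2 * Q) * (j - 2 * Q - 1))
        * cert (2 * n - j) i j (Q + 1)
        / ((2 * ((n : ℝ) - Q) - j + 1) * (2 * ((n : ℝ) - Q) - j)) := by
  have summand : ∀ q N : ℕ, 2 * q ≤ j → n = N + 1 + q →
      (recDen (2 * n - j) i * topFactor i j (N + 2)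
        + recMid (2 * n - j) i j * topFactor i j (N + 1)
        + recLast (2 * n - j) i * topFactor i j N) *
          ((2 * N - j + 5) * (2 * N - j + 4) * ((2 * N - j + 3) * (2 * N - j + 2))) =
      topFactor i j N *
        ((2 * N - j + 5) * (2 * N - j + 4) * ((j - 2 * q) * (j - 2 * q - 1))
            * cert (2 * n - j) i j (q + 1)
          - 2 * q * (2 * q - i) * ((2 * N - i + 1) * (2 * N + 3)) * cert (2 * n - j) i j q) := by
    intro q N hq hn
    have h₁ := topFactor_succ i j N hi (by omega) (by omega)
    have h₂ := topFactor_succ i j (N + 1) hi (by omega) (by omega)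
    have hid := cert_identity (2 * n - j) i j q (2 * N - j + 2) (by rw [hn]; push_cast; ring)
    push_cast at h₂
    rw [show N + 1 + 1 = N + 2 from rfl] at h₂
    generalize cert (2 * n - j) i j (q + 1) = x' at hid ⊢
    generalize cert (2 * n - j) i j q = x at hid ⊢
    generalize recDen (2 * n - j) i = D at hid ⊢
    generalize recMid (2 * n - j) i j = K at hid ⊢
    generalize recLast (2 * n - j) i = L at hid ⊢
    linear_combination topFactor i j N * hid
      + D * ((2 * N - j + 3) * (2 * N - j + 2)) * h₂
      + (D * ((2 * N - i + 3) * (2 * N + 5)) + K * ((2 * N - j + 5) * (2 * N - j + 4))) * h₁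
  induction Q with
  | zero =>
    obtain ⟨N, rfl⟩ : ∃ N, n = N + 1 := ⟨n - 1, by omega⟩
    have h := summand 0 N (by omega) (by omega)
    have hjN : (j : ℝ) ≤ 2 * N := by exact_mod_cast (by omega : j ≤ 2 * N)
    simp only [zero_add, Finset.sum_range_one, Nat.sub_zero, Nat.add_sub_cancel]
    rw [show N + 1 + 1 = N + 2 from rfl]
    push_cast at h ⊢
    have e₁ : 2 * (N : ℝ) - j + 2 ≠ 0 := by linarith
    have e₂ : 2 * (N : ℝ) - j + 3 ≠ 0 := by linarith
    have e₃ : 2 * (N : ℝ) - j + 4 ≠ 0 := by linarith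
    have e₄ : 2 * (N : ℝ) - j + 5 ≠ 0 := by linarith
    rw [show 2 * ((N : ℝ) + 1 - 0) - j + 1 = 2 * N - j + 3 by ring,
      show 2 * ((N : ℝ) + 1 - 0) - j = 2 * N - j + 2 by ring, eq_div_iff (mul_ne_zero e₂ e₁)]
    apply mul_right_cancel₀ (mul_ne_zero e₄ e₃)
    -- The lower boundary term contains the factor `q = 0`.
    simp only [mul_zero, zero_mul, sub_zero, zero_add] at h ⊢
    linear_combination lowFactor i j 0 * h
  | succ Q ih =>
    obtain ⟨N, hN⟩ : ∃ N, n = N + 1 + (Q + 1) := ⟨n - 1 - (Q + 1), by omega⟩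
    have h := summand (Q + 1) N hQ hN
    have ht := topFactor_succ i j N hi (by omega) (by omega)
    have hl := lowFactor_succ i j Q hi (by omega)
    have hjN : (j : ℝ) ≤ 2 * N := by exact_mod_cast (by omega : j ≤ 2 * N)
    have e₁ : 2 * (N : ℝ) - j + 2 ≠ 0 := by linarith
    have e₂ : 2 * (N : ℝ) - j + 3 ≠ 0 := by linarith
    have e₃ : 2 * (N : ℝ) - j + 4 ≠ 0 := by linarith
    have e₄ : 2 * (N : ℝ) - j + 5 ≠ 0 := by linarith
    have hnR : (n : ℝ) = N + 1 + (Q + 1) := by rw [hN]; push_cast; ring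
    rw [Finset.sum_range_succ, ih (by omega), show n + 1 - (Q + 1) = N + 2 by omega,
      show n - (Q + 1) = N + 1 by omega, show n - 1 - (Q + 1) = N by omega,
      show n - 1 - Q = N + 1 by omega]
    push_cast at h ⊢
    rw [show 2 * ((n : ℝ) - (Q + 1)) - j + 1 = 2 * N - j + 3 by rw [hnR]; ring,
      show 2 * ((n : ℝ) - (Q + 1)) - j = 2 * N - j + 2 by rw [hnR]; ring,
      show 2 * ((n : ℝ) - Q) - j + 1 = 2 * N - j + 5 by rw [hnR]; ring,
      show 2 * ((n : ℝ) - Q) - j = 2 * N - j + 4 by rw [hnR]; ring]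
    generalize cert (2 * n - j) i j (Q + 1 + 1) = x' at h ⊢
    generalize cert (2 * n - j) i j (Q + 1) = x at h ⊢
    generalize recDen (2 * n - j) i = D at h ⊢
    generalize recMid (2 * n - j) i j = K at h ⊢
    generalize recLast (2 * n - j) i = L at h ⊢
    rw [div_add' _ _ _ (mul_ne_zero e₄ e₃), div_eq_div_iff (mul_ne_zero e₄ e₃) (mul_ne_zero e₂ e₁)]
    -- `ht` and `hl` rewrite the previous boundary term at `N` and `Q + 1`, where it cancels the
    -- subtracted part of `h`.
    linear_combination lowFactor i j (Q + 1) * h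
      + x * lowFactor i j Q * ((j - 2 * Q) * (j - 2 * Q - 1)) * ht
      - x * topFactor i j N * ((2 * N - i + 1) * (2 * N + 3)) * hl

theorem entrySum_recurrence (n i j : ℕ) (hi : Odd i) (hji : j < i) (hin : i < n) :
    recDen (2 * n - j) i * entrySum (n + 1) i j + recMid (2 * n - j) i j * entrySum n i j
      + recLast (2 * n - j) i * entrySum (n - 1) i j = 0 := by
  have h := partial_sum_eq n i j (j / 2) hi hji hin (by omega)
  -- The upper boundary term vanishes: one factor for even `j`, the other for odd `j`.
  have h0 : ((j : ℝ) - 2 * (j / 2 : ℕ)) * (j - 2 * (j / 2 : ℕ) - 1) = 0 := by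
    rcases Nat.mod_two_eq_zero_or_one j with hj | hj
    · have : (j : ℝ) = 2 * (j / 2 : ℕ) := by exact_mod_cast (by omega : j = 2 * (j / 2))
      rw [sub_eq_zero.2 this, zero_mul]
    · have : (j : ℝ) = 2 * (j / 2 : ℕ) + 1 := by exact_mod_cast (by omega : j = 2 * (j / 2) + 1)
      rw [mul_eq_zero]; right; linarith
  rw [h0, mul_zero, zero_mul, zero_div] at h
  rw [← h]
  simp only [entrySum, Finset.mul_sum, ← Finset.sum_add_distrib]
  exact Finset.sum_congr rfl fun q _ => by ring

/-! ### Matrix entries as hypergeometric sums -/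

theorem poch_natCast_add_one (m k : ℕ) :
    poch ((m : ℝ) + 1) k = (m + k).factorial / m.factorial := by
  have h : ((m : ℝ) + 1) = ((m + 1 : ℕ) : ℝ) := by push_cast; ring
  rw [poch, h, ascPochhammer_nat_eq_natCast_ascFactorial, eq_div_iff (by positivity), mul_comm]
  exact_mod_cast Nat.factorial_mul_ascFactorial m k

theorem poch_one (k : ℕ) : poch 1 k = k.factorial := by
  simpa using poch_natCast_add_one 0 k

theorem poch_neg_natCast (n k : ℕ) (hk : k ≤ n) :
    poch (-(n : ℝ)) k = (-1) ^ k * (n.factorial / (n - k).factorial) := by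
  rw [poch, ascPochhammer_eval_neg_eq_descPochhammer, descPochhammer_eval_eq_descFactorial]
  congr 1
  rw [eq_div_iff (by positivity), mul_comm]
  exact_mod_cast Nat.factorial_mul_descFactorial hk

theorem waveCoeff_eq_zero (n i q : ℕ) (hq : 2 * q + 1 ≤ n) (hqi : q < (i - 1) / 2) :
    waveCoeff n i (n - (2 * q + 1)) = 0 := by
  unfold waveCoeff
  rw [mul_eq_zero]
  right
  apply Finset.prod_eq_zero (Finset.mem_range.2 hqi)
  rw [Nat.cast_sub hq]
  push_cast
  ring

theorem waveCoeff_mul_moment (n i j q : ℕ) (hi : Odd i) (hji : j < i) (hin : i ≤ n)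
    (hq : 2 * q ≤ j) :
    waveCoeff n i (n - 2 * q) *
      (((n - 2 * q).factorial * (n - 2 * q).factorial : ℝ) /
        ((n - 2 * q - (n - j)).factorial * (n - 2 * q + (n - j) + 1).factorial)) =
      -√(2 * (n : ℝ) - 2 * i + 1) * (topFactor i j (n - q) * lowFactor i j q) := by
  have hnq : ((n - 2 * q : ℕ) : ℝ) = n - 2 * q := by
    rw [Nat.cast_sub (by omega)]; push_cast; ring
  have hnq' : ((n - q : ℕ) : ℝ) = n - q := Nat.cast_sub (by omega)
  unfold waveCoeff topFactor lowFactor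
  rw [show ((n : ℝ) - i + 1) = ((n - i : ℕ) : ℝ) + 1 by rw [Nat.cast_sub hin],
    poch_natCast_add_one, poch_one, poch_neg_natCast n i hin,
    poch_neg_natCast n _ (by omega : n - 2 * q ≤ n), hi.neg_one_pow,
    show n - (n - 2 * q) = 2 * q by omega, show n - 2 * q - (n - j) = j - 2 * q by omega,
    show n - 2 * q + (n - j) + 1 = 2 * (n - q) + 1 - j by omega,
    show n - i + (n - 2 * q) = 2 * (n - q) - i by omega, hnq, hnq']
  have h₁ : ∏ m ∈ Finset.range ((i + 1) / 2), ((n : ℝ) + (n - 2 * q) + 1 - 2 * m) =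
      ∏ m ∈ Finset.range ((i + 1) / 2), (2 * ((n : ℝ) - q) + 1 - 2 * m) :=
    Finset.prod_congr rfl fun m _ => by ring
  have h₂ : ∏ m ∈ Finset.range ((i - 1) / 2), ((n : ℝ) - (n - 2 * q) - 1 - 2 * m) =
      ∏ m ∈ Finset.range ((i - 1) / 2), (2 * (q : ℝ) - 1 - 2 * m) :=
    Finset.prod_congr rfl fun m _ => by ring
  -- The remaining sign, from `poch (-n) i` with `i` odd, is the overall minus.
  have h₃ : ((-1 : ℝ) ^ n) * (-1) ^ (n - 2 * q) = 1 := by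
    rw [← pow_add]
    exact Even.neg_one_pow ⟨n - q, by omega⟩
  rw [h₁, h₂]
  generalize ∏ m ∈ Finset.range ((i + 1) / 2), (2 * ((n : ℝ) - q) + 1 - 2 * m) = A
  generalize ∏ m ∈ Finset.range ((i - 1) / 2), (2 * (q : ℝ) - 1 - 2 * m) = B
  generalize √(2 * (n : ℝ) - 2 * i + 1) = r
  have f₁ : (n.factorial : ℝ) ≠ 0 := by positivity
  have f₂ : ((n - i).factorial : ℝ) ≠ 0 := by positivity
  have f₃ : ((2 * q).factorial : ℝ) ≠ 0 := by positivity
  have f₄ : ((j - 2 * q).factorial : ℝ) ≠ 0 := by positivity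
  have f₅ : ((2 * (n - q) + 1 - j).factorial : ℝ) ≠ 0 := by positivity
  have f₆ : ((n - 2 * q).factorial : ℝ) ≠ 0 := by positivity
  generalize (-1 : ℝ) ^ n = s at h₃ ⊢
  generalize (-1 : ℝ) ^ (n - 2 * q) = s' at h₃ ⊢
  field_simp
  linear_combination -(r * A * B) * h₃

theorem matD_eq_entrySum (n i j r s : ℕ) (hr : r < n + 1) (hs : s < n + 1) (hi : Odd i)
    (hji : j < i) (hin : i ≤ n) (hri : r + i = n) (hsj : s + j = n) :
    matD n ⟨r, hr⟩ ⟨s, hs⟩ =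
      -(2 / √2) * (√(2 * ((n : ℝ) - i) + 1) * √(2 * ((n : ℝ) - j) + 1)) * entrySum n i j := by
  obtain rfl : r = n - i := by omega
  obtain rfl : s = n - j := by omega
  rw [matD_eq_sum n i (n - j) hi hin hs, Nat.cast_sub (by omega : j ≤ n)]
  have key : ∑ k ∈ Finset.range (n + 1), waveCoeff n i k *
      (if n - j ≤ k then
        (k.factorial * k.factorial : ℝ) / ((k - (n - j)).factorial * (k + (n - j) + 1).factorial)
      else 0) = -√(2 * (n : ℝ) - 2 * i + 1) * entrySum n i j := by
    rw [entrySum, Finset.mul_sum]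
    symm
    apply Finset.sum_of_injOn (fun q => n - 2 * q)
    · intro p hp q hq hpq
      simp only [Finset.coe_range, Set.mem_Iio] at hp hq hpq
      omega
    · intro q hq
      simp only [Finset.coe_range, Set.mem_Iio] at hq ⊢
      omega
    · intro k hk hk'
      simp only [Finset.coe_range, Set.mem_image, Set.mem_Iio, Finset.mem_range, not_exists,
        not_and] at hk hk'
      split_ifs with h
      -- If `n - k = 2 q + 1`, then `2 q + 1 ≤ j < i` puts `m = q` in the range of the vanishing
      -- product.
      · rcases Nat.even_or_odd' (n - k) with ⟨q, hq | hq⟩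
        · exact absurd (by omega) (hk' q (by omega))
        · obtain ⟨c, rfl⟩ := hi
          rw [show k = n - (2 * q + 1) by omega, waveCoeff_eq_zero n _ q (by omega) (by omega),
            zero_mul]
      · rw [mul_zero]
    · intro q hq
      rw [Finset.mem_range] at hq
      rw [if_pos (by omega), waveCoeff_mul_moment n i j q hi hji hin (by omega)]
  rw [key, show 2 * ((n : ℝ) - i) + 1 = 2 * (n : ℝ) - 2 * i + 1 by ring]
  ring

/-! ### Matching the stated coefficients -/

theorem recMid_div_recDen (n i j : ℝ) (h₀ : 0 ≤ j) (h₁ : j + 1 ≤ i) (h₂ : i + 1 ≤ n) :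
    (2 * n - i - j + 1) / (2 * n - j + 2) *
      ((-j / 2 * ((j - i + 1) / 2) * (n + (3 - j) / 2 - (-n + (i + j) / 2)) -
          (-n + (i + j) / 2) * (1 - (n + (3 - j) / 2)) * (1 / 2 - (n + (3 - j) / 2)) *
            (3 / 2 - (n + (3 - j) / 2)) / (n + (3 - j) / 2 - (-n + (i + j) / 2) - 1)) *
        ((1 + (n + (3 - j) / 2) - (-n + (i + j) / 2)) / ((n + (3 - j) / 2) *
          (1 - (-n + (i + j) / 2)) * (1 / 2 - (-n + (i + j) / 2)) *
            (3 / 2 - (-n + (i + j) / 2)))) - 1) =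
      recMid (2 * n - j) i j / recDen (2 * n - j) i := by
  -- In `M = 2 n - j` every denominator depends on `M` and `i` alone.
  obtain ⟨M, rfl⟩ : ∃ M, n = (M + j) / 2 := ⟨2 * n - j, by ring⟩
  have e₁ : M + 2 ≠ 0 := by linarith
  have e₂ : 2 * M - i + 1 ≠ 0 := by linarith
  have e₃ : M + 3 ≠ 0 := by linarith
  have e₄ : M + 2 - i ≠ 0 := by linarith
  have e₅ : M + 3 - i ≠ 0 := by linarith
  have e₆ : M - i + 1 ≠ 0 := by linarith
  unfold recMid recDen
  rw [show 2 * ((M + j) / 2) - i - j + 1 = M - i + 1 by ring,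
    show 2 * ((M + j) / 2) - j + 2 = M + 2 by ring,
    show (M + j) / 2 + (3 - j) / 2 - (-((M + j) / 2) + (i + j) / 2) - 1 = (2 * M - i + 1) / 2 by
      ring,
    show 1 - (-((M + j) / 2) + (i + j) / 2) = (M + 2 - i) / 2 by ring,
    show 1 / 2 - (-((M + j) / 2) + (i + j) / 2) = (M - i + 1) / 2 by ring,
    show 3 / 2 - (-((M + j) / 2) + (i + j) / 2) = (M + 3 - i) / 2 by ring,
    show (M + j) / 2 + (3 - j) / 2 = (M + 3) / 2 by ring,
    show 2 * ((M + j) / 2) - j = M by ring]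
  generalize hD : 2 * M - i + 1 = D at e₂ ⊢
  field_simp
  rw [← hD]
  ring

theorem recLast_div_recDen (n i j : ℝ) (h₀ : 0 ≤ j) (h₁ : j + 1 ≤ i) (h₂ : i + 1 ≤ n) :
    (2 * n - i - j - 1) * (2 * n - i - j + 1) / ((2 * n - j) * (2 * n - j + 2)) *
      ((-n + (i + j) / 2) * (1 - (n + (3 - j) / 2)) * (1 / 2 - (n + (3 - j) / 2)) *
          (3 / 2 - (n + (3 - j) / 2)) * (1 + (n + (3 - j) / 2) - (-n + (i + j) / 2)) /
        ((n + (3 - j) / 2 - (-n + (i + j) / 2) - 1) * (n + (3 - j) / 2) *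
          (1 - (-n + (i + j) / 2)) * (1 / 2 - (-n + (i + j) / 2)) *
            (3 / 2 - (-n + (i + j) / 2)))) =
      recLast (2 * n - j) i / recDen (2 * n - j) i := by
  obtain ⟨M, rfl⟩ : ∃ M, n = (M + j) / 2 := ⟨2 * n - j, by ring⟩
  have e₀ : M ≠ 0 := by linarith
  have e₁ : M + 2 ≠ 0 := by linarith
  have e₂ : 2 * M - i + 1 ≠ 0 := by linarith
  have e₃ : M + 3 ≠ 0 := by linarith
  have e₄ : M + 2 - i ≠ 0 := by linarith
  have e₅ : M + 3 - i ≠ 0 := by linarith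
  have e₆ : M - i + 1 ≠ 0 := by linarith
  unfold recLast recDen
  rw [show 2 * ((M + j) / 2) - i - j + 1 = M - i + 1 by ring,
    show 2 * ((M + j) / 2) - j + 2 = M + 2 by ring,
    show (M + j) / 2 + (3 - j) / 2 - (-((M + j) / 2) + (i + j) / 2) - 1 = (2 * M - i + 1) / 2 by
      ring,
    show 1 - (-((M + j) / 2) + (i + j) / 2) = (M + 2 - i) / 2 by ring,
    show 1 / 2 - (-((M + j) / 2) + (i + j) / 2) = (M - i + 1) / 2 by ring,
    show 3 / 2 - (-((M + j) / 2) + (i + j) / 2) = (M + 3 - i) / 2 by ring,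
    show (M + j) / 2 + (3 - j) / 2 = (M + 3) / 2 by ring,
    show 2 * ((M + j) / 2) - j = M by ring]
  field_simp
  ring

theorem mul_div_mul_cancel_norm (R u v r X : ℝ) (hr : r ≠ 0) :
    R * u / (r * v) * X * r = R * (u / v * X) := by
  rw [mul_div_mul_comm]
  field_simp

end AlpertWavelet

theorem theorem7 (n i j : ℕ) (hi : Odd i) (hji : j < i) (hin : i < n) :
    let N : ℝ := n
    let I : ℝ := i
    let J : ℝ := j
    let a : ℝ := N + (3 - J) / 2
    let b : ℝ := -N + (I + J) / 2
    let c : ℝ := -J / 2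
    let d : ℝ := (J - I + 1) / 2
    let e : ℝ := 1
    let f : ℝ := 1 / 2
    let g : ℝ := 3 / 2
    let h : ℝ := (√(2 * (N - I) + 3) * √(2 * (N - J) + 3) * (2 * N - I - J + 1)) /
      (√(2 * (N - I) + 1) * √(2 * (N - J) + 1) * (2 * N - J + 2))
    let l : ℝ := (√(2 * (N - I) + 3) * √(2 * (N - J) + 3) *
        (2 * N - I - J - 1) * (2 * N - I - J + 1)) /
      (√(2 * (N - I) - 1) * √(2 * (N - J) - 1) * (2 * N - J) * (2 * N - J + 2))
    let k₁ : ℝ := h * ((c * d * (a - b) - b * (e - a) * (f - a) * (g - a) / (a - b - 1)) *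
      ((1 + a - b) / (a * (e - b) * (f - b) * (g - b))) - 1)
    let k₂ : ℝ := l * ((b * (e - a) * (f - a) * (g - a) * (1 + a - b)) /
      ((a - b - 1) * a * (e - b) * (f - b) * (g - b)))
    AlpertWavelet.matD (n + 1) ⟨n - i + 1, by omega⟩ ⟨n - j + 1, by omega⟩
      + k₁ * AlpertWavelet.matD n ⟨n - i, by omega⟩ ⟨n - j, by omega⟩
      + k₂ * AlpertWavelet.matD (n - 1) ⟨n - i - 1, by omega⟩ ⟨n - j - 1, by omega⟩ = 0 := by
  intro N I J a b c d e f g h l k₁ k₂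
  have hJ : (0 : ℝ) ≤ J := Nat.cast_nonneg j
  have hJI : J + 1 ≤ I := by
    change (j : ℝ) + 1 ≤ i
    exact_mod_cast Nat.succ_le_of_lt hji
  have hIN : I + 1 ≤ N := by
    change (i : ℝ) + 1 ≤ n
    exact_mod_cast Nat.succ_le_of_lt hin
  have hrec := AlpertWavelet.entrySum_recurrence n i j hi hji hin
  have hk₁ := AlpertWavelet.recMid_div_recDen N I J hJ hJI hIN
  have hk₂ := AlpertWavelet.recLast_div_recDen N I J hJ hJI hIN
  have hden : AlpertWavelet.recDen (2 * N - J) I ≠ 0 := by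
    unfold AlpertWavelet.recDen
    refine mul_ne_zero (mul_ne_zero (mul_ne_zero (mul_ne_zero ?_ ?_) ?_) ?_) ?_ <;> linarith
  rw [AlpertWavelet.matD_eq_entrySum (n + 1) i j _ _ _ _ hi hji (by omega) (by omega) (by omega),
    AlpertWavelet.matD_eq_entrySum n i j _ _ _ _ hi hji (by omega) (by omega) (by omega),
    AlpertWavelet.matD_eq_entrySum (n - 1) i j _ _ _ _ hi hji (by omega) (by omega) (by omega),
    Nat.cast_sub (by omega : 1 ≤ n)]
  push_cast
  change AlpertWavelet.recDen (2 * N - J) I * _ + AlpertWavelet.recMid (2 * N - J) I J * _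
    + AlpertWavelet.recLast (2 * N - J) I * _ = 0 at hrec
  rw [show 2 * ((n : ℝ) + 1 - i) + 1 = 2 * (N - I) + 3 by ring,
    show 2 * ((n : ℝ) + 1 - j) + 1 = 2 * (N - J) + 3 by ring,
    show 2 * ((n : ℝ) - i) + 1 = 2 * (N - I) + 1 by ring,
    show 2 * ((n : ℝ) - j) + 1 = 2 * (N - J) + 1 by ring,
    show 2 * ((n : ℝ) - 1 - i) + 1 = 2 * (N - I) - 1 by ring,
    show 2 * ((n : ℝ) - 1 - j) + 1 = 2 * (N - J) - 1 by ring]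
  have s₁ : √(2 * (N - I) + 1) ≠ 0 := (Real.sqrt_pos.2 (by linarith)).ne'
  have s₂ : √(2 * (N - J) + 1) ≠ 0 := (Real.sqrt_pos.2 (by linarith)).ne'
  have s₃ : √(2 * (N - I) - 1) ≠ 0 := (Real.sqrt_pos.2 (by linarith)).ne'
  have s₄ : √(2 * (N - J) - 1) ≠ 0 := (Real.sqrt_pos.2 (by linarith)).ne'
  -- The radicals in `h` trade the normalization at `n` for that at `n + 1`; those in `l` do so from
  -- `n - 1`.
  have hk₁' : k₁ * (√(2 * (N - I) + 1) * √(2 * (N - J) + 1)) =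
      √(2 * (N - I) + 3) * √(2 * (N - J) + 3) *
        (AlpertWavelet.recMid (2 * N - J) I J / AlpertWavelet.recDen (2 * N - J) I) := by
    rw [← hk₁]
    exact AlpertWavelet.mul_div_mul_cancel_norm _ _ _ _ _ (mul_ne_zero s₁ s₂)
  have hk₂' : k₂ * (√(2 * (N - I) - 1) * √(2 * (N - J) - 1)) =
      √(2 * (N - I) + 3) * √(2 * (N - J) + 3) *
        (AlpertWavelet.recLast (2 * N - J) I / AlpertWavelet.recDen (2 * N - J) I) := by
    have hl : l = √(2 * (N - I) + 3) * √(2 * (N - J) + 3) *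
        ((2 * N - I - J - 1) * (2 * N - I - J + 1)) /
        (√(2 * (N - I) - 1) * √(2 * (N - J) - 1) * ((2 * N - J) * (2 * N - J + 2))) := by
      simp only [l, mul_assoc]
    rw [← hk₂, ← AlpertWavelet.mul_div_mul_cancel_norm _ _ _ _ _ (mul_ne_zero s₃ s₄), ← hl]
  clear_value k₁ k₂
  generalize √(2 * (N - I) + 3) * √(2 * (N - J) + 3) = R at hk₁' hk₂' ⊢
  have hrec' : AlpertWavelet.entrySum (n + 1) i j
      + AlpertWavelet.recMid (2 * N - J) I J / AlpertWavelet.recDen (2 * N - J) I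
        * AlpertWavelet.entrySum n i j
      + AlpertWavelet.recLast (2 * N - J) I / AlpertWavelet.recDen (2 * N - J) I
        * AlpertWavelet.entrySum (n - 1) i j = 0 := by
    field_simp
    linear_combination hrec
  linear_combination -(2 / √2) * AlpertWavelet.entrySum n i j * hk₁'
    - 2 / √2 * AlpertWavelet.entrySum (n - 1) i j * hk₂' - 2 / √2 * R * hrec'
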